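/- Let $n\ge 0$, $H_{\mathbb Z}=\mathbb Z^{2n}$, let $Q$ be the bilinear form on $H_{\mathbb Z}$ with matrix $\begin{pmatrix}0&I\\-I&0\end{pmatrix}$, and $\mathfrak g_A=\mathfrak{sp}(H_A,Q)$ for $A=\mathbb Q,\mathbb R,\mathbb C$. Fix Hodge numbers $\{h^{p,-p-1}\}_{p\in\mathbb Z}$. Let $\check D$ be the set of finite decreasing filtrations $F$ of $H_{\mathbb C}$ with $\dim F^p/F^{p+1}=h^{p,-p-1}$ and $(F^p)^{\perp}=F^{-p}$ for all $p$, and let $D\subset\check D$ be the period domain of $Q$-polarized Hodge structures of weight $-1$, that is, of those $F\in\check D$ with $H_{\mathbb C}=F^p\oplus\overline{F^{-p}}$ for all $p$ and $i^{2p+1}Q(v,\bar v)>0$ for $0\ne v\in F^p\cap\overline{F^{-p-1}}$. A nilpotent cone is a cone $\sigma=\sum_{j=1}^{\ell}\mathbb R_{\ge 0}N_j\subset\mathfrak g_{\mathbb R}$ generated by mutually commuting nilpotent elements $N_1,\dots,N_\ell\in\mathfrak g_{\mathbb Q}$; let $\sigma^\circ$ be its relative interior. For $F\in\check D$, $(\sigma,\exp(\sigma_{\mathbb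 C})F)$ is a ($\sigma$-)nilpotent orbit if $\exp(\sum_j ix_jN_j)F\in D$ whenever all $x_j\gg 0$, and $NF^p\subset F^{p-1}$ for all $N\in\sigma$ and all $p$. Assume that $\sigma$ generates a nilpotent orbit, i.e. that a $\sigma$-nilpotent orbit exists, and let $W=W(\sigma)$ be the monodromy weight filtration on $H_{\mathbb R}$, centered at $-1$, of an element of $\sigma^\circ$ (by Cattani and Kaplan all elements of $\sigma^\circ$ have the same one). For a $\sigma$-nilpotent orbit given by $F$ let $H_{\mathbb C}=\bigoplus_{p,q}I^{p,q}$ be the Deligne decomposition of the mixed Hodge structure $(W,F)$. The nilpotent orbit is called even-type (resp. odd-type) if $N^2=0$ for all $N\in\sigma$ and $I^{p,-p}=0$ for every odd (resp. even) integer $p$. The cone $\sigma$ is called even-type (resp. odd-type) if it generates a nilpotent orbit and all $\sigma$-nilpotent orbits are even-type (resp. odd-type). For a subspace $S\subset H_{\mathbb R}$ put $\eta(S)=\{N\in\mathfrak g_{\mathbb R} : \operatorname{Im}N\subset S\}$ and let $\eta^+(S)$ be the set of $N\in\eta(S)$ for which the bilinear form $\phi_N=Q(\bullet,N\bullet)$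 is positive definite on $H_{\mathbb R}/S^{\perp}$. Then $\sigma^\circ\subset\eta^+(W_{-2})$ if and only if $\sigma$ is even-type, and $\sigma^\circ\subset-\eta^+(W_{-2})$ if and only if $\sigma$ is odd-type. -/

import Mathlib

open scoped Pointwise

noncomputable section

namespace HodgeCone

/-- The index set of the standard basis `e₁, …, e₂ₙ`. -/
abbrev Idx (n : ℕ) : Type := Fin n ⊕ Fin n

/-- `H_R = R²ⁿ`, i.e. `H_ℤ ⊗ R` for the standard lattice `H_ℤ = ℤ²ⁿ`. -/
abbrev H (n : ℕ) (R : Type) : Type := Idx n → R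

/-- Endomorphisms of `H_R`, as matrices. -/
abbrev EndMat (n : ℕ) (R : Type) : Type := Matrix (Idx n) (Idx n) R

/-- The bilinear form on `H_R` with matrix `(0, I; -I, 0)`. -/
def Q (n : ℕ) (R : Type) [CommRing R] : H n R →ₗ[R] H n R →ₗ[R] R :=
  Matrix.toLinearMap₂' R (Matrix.fromBlocks 0 1 (-1) 0 : EndMat n R)

/-- The complexification of a real endomorphism. -/
def toC {n : ℕ} (N : EndMat n ℝ) : EndMat n ℂ := N.map Complex.ofReal

/-- The complexification `S_ℂ ⊆ H_ℂ` of a real subspace `S ⊆ H_ℝ`. -/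
def complexify {n : ℕ} (S : Submodule ℝ (H n ℝ)) : Submodule ℂ (H n ℂ) :=
  Submodule.span ℂ ((fun (v : H n ℝ) (i : Idx n) => (v i : ℂ)) '' (S : Set (H n ℝ)))

/-- The complex conjugate of a complex subspace of `H_ℂ` (`star` is coordinatewise conjugation). -/
def conj {n : ℕ} (U : Submodule ℂ (H n ℂ)) : Submodule ℂ (H n ℂ) where
  carrier := {v | star v ∈ U}
  add_mem' {a b} ha hb := by
    simpa only [Set.mem_ofPred_eq, star_add] using U.add_mem ha hb
  zero_mem' := by simp
  smul_mem' c v hv := by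
    simpa only [Set.mem_ofPred_eq, star_smul] using U.smul_mem (star c) hv

/-- The translate `g F` of a filtration `F` of `H_ℂ`. -/
def translate {n : ℕ} (g : EndMat n ℂ) (F : ℤ → Submodule ℂ (H n ℂ)) :
    ℤ → Submodule ℂ (H n ℂ) :=
  fun p => (F p).map (Matrix.mulVecLin g)

/-! ### Period domains of weight `-1` -/

/-- The compact dual for the Hodge numbers `h p = h^{p,-p-1}`: finite decreasing filtrations of
`H_ℂ` with `dim F^p / F^{p+1} = h^{p,-p-1}` and with `F^{-p}` the `Q`-orthogonal of `F^p`. -/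
structure IsInCompactDual {n : ℕ} (h : ℤ → ℕ) (F : ℤ → Submodule ℂ (H n ℂ)) : Prop where
  antitone : Antitone F
  exists_top : ∃ p, F p = ⊤
  exists_bot : ∃ p, F p = ⊥
  finrank_eq : ∀ p, Module.finrank ℂ (F p) = Module.finrank ℂ (F (p + 1)) + h p
  orthogonal : ∀ p, (F p).orthogonalBilin (Q n ℂ) = F (-p)

/-- The component `H^{p,-p-1} = F^p ∩ conj F^{-p-1}`. -/
def hodgeComponent {n : ℕ} (F : ℤ → Submodule ℂ (H n ℂ)) (p : ℤ) : Submodule ℂ (H n ℂ) :=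
  F p ⊓ conj (F (-p - 1))

/-- The period domain `D` of `Q`-polarized Hodge structures of weight `-1`: `F` is opposed to its
conjugate in weight `-1`, and `i^{p-q} Q(v, v̄) > 0` for `0 ≠ v ∈ H^{p,q}`, `q = -p-1`. -/
structure IsInPeriodDomain {n : ℕ} (h : ℤ → ℕ) (F : ℤ → Submodule ℂ (H n ℂ)) : Prop extends
    IsInCompactDual h F where
  opposed : ∀ p, IsCompl (F p) (conj (F (-p)))
  /-- The number in question is automatically real, since `Q` is real and alternating. -/
  positive : ∀ p, ∀ v ∈ hodgeComponent F p, v ≠ 0 →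
    0 < (Complex.I ^ (2 * p + 1) * Q n ℂ v (star v)).re

/-! ### Nilpotent cones and nilpotent orbits -/

/-- A nilpotent cone in `𝔤 = 𝔰𝔭(2n, ℝ)`, given by finitely many generators: mutually commuting
rational nilpotent elements of `𝔤`. -/
structure NilpotentCone (n : ℕ) where
  /-- the number of generators -/
  len : ℕ
  /-- the generators `N₁, …, N_ℓ` -/
  gen : Fin len → EndMat n ℝ
  gen_mem : ∀ j, gen j ∈ LieAlgebra.Symplectic.sp (Fin n) ℝ
  gen_rational : ∀ j, ∃ M : EndMat n ℚ, gen j = M.map (fun q : ℚ => (q : ℝ))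
  gen_nilpotent : ∀ j, IsNilpotent (gen j)
  gen_commute : ∀ j k, Commute (gen j) (gen k)

namespace NilpotentCone

variable {n : ℕ} (σ : NilpotentCone n)

/-- The cone `σ = ∑ ℝ_{≥0} N_j` itself. -/
def cone : PointedCone ℝ (EndMat n ℝ) := PointedCone.hull ℝ (Set.range σ.gen)

/-- The relative interior `σ°`. -/
def relInt : Set (EndMat n ℝ) := intrinsicInterior ℝ (σ.cone : Set (EndMat n ℝ))

/-- `(σ, exp(σ_ℂ) F)` is a nilpotent orbit for the period domain with Hodge numbers `h`. -/
structure IsNilpotentOrbit (h : ℤ → ℕ) (F : ℤ → Submodule ℂ (H n ℂ)) : Prop where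
  compactDual : IsInCompactDual h F
  /-- `exp(∑ i x_j N_j) F ∈ D` if all `x_j ≫ 0` -/
  eventually_mem : ∃ c : ℝ, ∀ x : Fin σ.len → ℝ, (∀ j, c < x j) →
    IsInPeriodDomain h
      (translate (NormedSpace.exp (∑ j, (Complex.I * (x j : ℂ)) • toC (σ.gen j))) F)
  /-- `N F^p ⊆ F^{p-1}` -/
  horizontal : ∀ N ∈ σ.cone, ∀ p, (F p).map (Matrix.mulVecLin (toC N)) ≤ F (p - 1)

end NilpotentCone

/-! ### Weight filtrations and the Deligne decomposition -/

/-- `W` is the monodromy weight filtration of the nilpotent endomorphism `N`, centered at `-1`: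
the finite increasing filtration with `N W_k ⊆ W_{k-2}` such that `N^k` induces, for `k ≥ 0`, an
isomorphism `W_{-1+k} / W_{-2+k} ≅ W_{-1-k} / W_{-2-k}`. -/
structure IsMonodromyWeightFiltration {n : ℕ} (N : EndMat n ℝ)
    (W : ℤ → Submodule ℝ (H n ℝ)) : Prop where
  monotone : Monotone W
  exists_bot : ∃ k, W k = ⊥
  exists_top : ∃ k, W k = ⊤
  map_le : ∀ k, (W k).map (Matrix.mulVecLin N) ≤ W (k - 2)
  gr_injective : ∀ k : ℕ, ∀ v ∈ W (-1 + k), (N ^ k).mulVec v ∈ W (-2 - k) → v ∈ W (-2 + k)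
  gr_surjective : ∀ k : ℕ,
    W (-1 - k) ≤ (W (-1 + k)).map (Matrix.mulVecLin (N ^ k)) ⊔ W (-2 - k)

/-- `W = W(σ)`: the monodromy weight filtration of an element of the relative interior of `σ`.
(If `σ` generates a nilpotent orbit, a theorem of Cattani and Kaplan says that all elements of
`σ°` have the same one. That theorem is not used: whatever is said below about `W(σ)` is said for
the filtrations of all elements of `σ°`.) -/
def NilpotentCone.IsWeightFiltration {n : ℕ} (σ : NilpotentCone n)
    (W : ℤ → Submodule ℝ (H n ℝ)) : Prop :=
  ∃ N ∈ σ.relInt, IsMonodromyWeightFiltration N W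

/-- The summand `I^{p,q}` of the Deligne decomposition of `(W, F)`:
`I^{p,q} = F^p ∩ W_{p+q} ∩ (conj F^q ∩ W_{p+q} + ∑_{j ≥ 1} conj F^{q-j} ∩ W_{p+q-j-1})`. -/
def deligne {n : ℕ} (W : ℤ → Submodule ℝ (H n ℝ)) (F : ℤ → Submodule ℂ (H n ℂ)) (p q : ℤ) :
    Submodule ℂ (H n ℂ) :=
  F p ⊓ complexify (W (p + q)) ⊓
    ((conj (F q) ⊓ complexify (W (p + q))) ⊔
      ⨆ j : ℕ, conj (F (q - (j + 1))) ⊓ complexify (W (p + q - (j + 1) - 1)))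

namespace NilpotentCone

variable {n : ℕ} (σ : NilpotentCone n)

/-- The conditions for a nilpotent orbit `(σ, exp(σ_ℂ) F)` to be even-type. -/
def IsEvenTypeOrbit (F : ℤ → Submodule ℂ (H n ℂ)) : Prop :=
  (∀ N ∈ σ.cone, N ^ 2 = 0) ∧
    ∀ W, σ.IsWeightFiltration W → ∀ p : ℤ, Odd p → deligne W F p (-p) = ⊥

/-- The conditions for a nilpotent orbit `(σ, exp(σ_ℂ) F)` to be odd-type. -/
def IsOddTypeOrbit (F : ℤ → Submodule ℂ (H n ℂ)) : Prop :=
  (∀ N ∈ σ.cone, N ^ 2 = 0) ∧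
    ∀ W, σ.IsWeightFiltration W → ∀ p : ℤ, Even p → deligne W F p (-p) = ⊥

/-- `σ` generates a nilpotent orbit. -/
def GeneratesNilpotentOrbit (h : ℤ → ℕ) : Prop := ∃ F, σ.IsNilpotentOrbit h F

/-- `σ` is even-type: it generates a nilpotent orbit and all `σ`-nilpotent orbits are even-type. -/
def IsEvenType (h : ℤ → ℕ) : Prop :=
  σ.GeneratesNilpotentOrbit h ∧ ∀ F, σ.IsNilpotentOrbit h F → σ.IsEvenTypeOrbit F

/-- `σ` is odd-type: it generates a nilpotent orbit and all `σ`-nilpotent orbits are odd-type. -/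
def IsOddType (h : ℤ → ℕ) : Prop :=
  σ.GeneratesNilpotentOrbit h ∧ ∀ F, σ.IsNilpotentOrbit h F → σ.IsOddTypeOrbit F

end NilpotentCone

/-! ### The cones `η⁺(S)` -/

/-- `η(S) = {N ∈ 𝔤 | Im N ⊆ S}`. -/
def eta {n : ℕ} (S : Submodule ℝ (H n ℝ)) : Set (EndMat n ℝ) :=
  {N | N ∈ LieAlgebra.Symplectic.sp (Fin n) ℝ ∧ LinearMap.range (Matrix.mulVecLin N) ≤ S}

/-- `η⁺(S) = {N ∈ η(S) | φ_N > 0 on H_ℝ / S^⊥}` with `φ_N(v, w) = Q(v, N w)`. The form `φ_N`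
descends to the quotient because `Im N ⊆ S`. -/
def etaPlus {n : ℕ} (S : Submodule ℝ (H n ℝ)) : Set (EndMat n ℝ) :=
  {N | N ∈ eta S ∧ ∀ v, v ∉ S.orthogonalBilin (Q n ℝ) → 0 < Q n ℝ v (N.mulVec v)}

end HodgeCone

end

/-! Suppose `N ∈ σ°` and `N² = 0`. Then `W₀ = H`, `W₋₁ = ker N`, `W₋₂ = im N`, `W₋₃ = 0`, and `Q(v,
N v̄)` is a Hermitian form, since `N` is skew for `Q`. Modulo `ker N` it lives on the sum of the
`I^{p,-p}`, which are mutually orthogonal for it, and the polarization of `exp(iyN)F`, as `y → ∞`,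
gives it the sign `(-1)^p` on `I^{p,-p}`. So it is positive semidefinite exactly when no odd `p`
occurs, and negative semidefinite exactly when no even `p` occurs (`SquareZeroOrbit.semidefinite`,
`SquareZeroOrbit.deligneZero_eq_bot`).

Two facts about cones complete the argument. If `im N ⊆ W₋₂` for all `N ∈ σ°`, then every element of
`σ` has square zero (both lemmas named `sq_zero_of_range_le`). If all forms `φ_N`, `N ∈ σ°`, are
semidefinite of the same sign, then moving slightly beyond a point of `σ°` shows that they have the
same kernel (`ker_le_of_semidefinite`). Hence all `N ∈ σ°` have image `W₋₂`, and semidefinite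
becomes definite on `H/W₋₂^⊥`.

The decompositions of `im T`, `ker T` and `F^p` used here are proved by duality from `(F^p)^⊥ =
F^{-p}` and the positivity of the polarization. -/

namespace HodgeCone

/-! ### The symplectic form -/

section Form

variable {n : ℕ} {K : Type} [Field K]

theorem Q_apply (v w : H n K) :
    Q n K v w = (∑ i, v (.inl i) * w (.inr i)) - ∑ i, v (.inr i) * w (.inl i) := by
  simp [Q, Matrix.toLinearMap₂'_apply', Matrix.fromBlocks_mulVec, dotProduct, Fintype.sum_sum_type,
    Matrix.neg_mulVec, sub_eq_add_neg]

theorem Q_swap (v w : H n K) : Q n K v w = -Q n K w v := by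
  rw [Q_apply, Q_apply]
  simp [mul_comm]

theorem Q_isRefl : LinearMap.BilinForm.IsRefl (Q n K) := fun v w hvw => by
  rw [Q_swap, hvw, neg_zero]

theorem Q_separating {v : H n K} (hv : ∀ w, Q n K w v = 0) : v = 0 := by
  funext i
  rcases i with i | i
  · simpa [Q_apply, Pi.single_apply] using hv (Pi.single (.inr i) 1)
  · simpa [Q_apply, Pi.single_apply] using hv (Pi.single (.inl i) 1)

theorem Q_nondegenerate : LinearMap.BilinForm.Nondegenerate (Q n K) :=
  ⟨fun v hv => Q_separating fun w => by rw [Q_swap, hv, neg_zero], fun _ hv => Q_separating hv⟩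

theorem orthogonal_orthogonal (U : Submodule K (H n K)) :
    (U.orthogonalBilin (Q n K)).orthogonalBilin (Q n K) = U :=
  LinearMap.BilinForm.orthogonal_orthogonal Q_nondegenerate Q_isRefl U

/-- Turns the claim that certain subspaces span `A` into a vanishing statement about a vector
orthogonal to all of them; each decomposition below starts this way. -/
theorem le_of_orthogonal_le {A B : Submodule K (H n K)}
    (h : ∀ u, (∀ b ∈ B, Q n K b u = 0) → ∀ a ∈ A, Q n K a u = 0) : A ≤ B := by
  intro a ha
  rw [← orthogonal_orthogonal B, Submodule.mem_orthogonalBilin_iff]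
  intro u hu
  rw [Q_swap, h u (fun b hb => Submodule.mem_orthogonalBilin_iff.1 hu b hb) a ha, neg_zero]

theorem mem_sup_of_orthogonal_inf {A B A' B' : Submodule K (H n K)} {u : H n K}
    (hA : A.orthogonalBilin (Q n K) ≤ A') (hB : B.orthogonalBilin (Q n K) ≤ B')
    (h : ∀ b ∈ A ⊓ B, Q n K b u = 0) : u ∈ A' ⊔ B' := by
  refine sup_le_sup hA hB ?_
  rw [← orthogonal_orthogonal (_ ⊔ _), Submodule.mem_orthogonalBilin_iff]
  intro b hb
  refine h b ⟨?_, ?_⟩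
  · rw [← orthogonal_orthogonal A]
    exact fun x hx => hb x (Submodule.mem_sup_left hx)
  · rw [← orthogonal_orthogonal B]
    exact fun x hx => hb x (Submodule.mem_sup_right hx)

end Form

theorem Q_star {n : ℕ} (v w : H n ℂ) : Q n ℂ (star v) (star w) = star (Q n ℂ v w) := by
  simp [Q_apply]

theorem neg_one_zpow_eq (p : ℤ) : (-1 : ℝ) ^ p = 1 ∨ (-1 : ℝ) ^ p = -1 :=
  (Int.even_or_odd p).imp Even.neg_one_zpow Odd.neg_one_zpow

theorem mem_conj {n : ℕ} {U : Submodule ℂ (H n ℂ)} {v : H n ℂ} : v ∈ conj U ↔ star v ∈ U := Iff.rfl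

/-! ### Nilpotent orbits of square-zero endomorphisms -/

/-- The linear algebra of a one-variable nilpotent orbit `exp(iyT)F` with `T² = 0`. -/
structure SquareZeroOrbit {n : ℕ} (T : H n ℂ →ₗ[ℂ] H n ℂ) (F : ℤ → Submodule ℂ (H n ℂ)) :
    Prop where
  map_star : ∀ v, T (star v) = star (T v)
  skew : ∀ v w, Q n ℂ (T v) w = -Q n ℂ v (T w)
  sq_zero : ∀ v, T (T v) = 0
  antitone : Antitone F
  exists_top : ∃ p, F p = ⊤
  exists_bot : ∃ p, F p = ⊥
  orthogonal : ∀ p, (F p).orthogonalBilin (Q n ℂ) = F (-p)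
  horizontal : ∀ p, ∀ v ∈ F p, T v ∈ F (p - 1)
  -- With `g = exp(iyT) = 1 + iyT`, the conjugate of `g v` is `g(v̄ - 2iyT v̄)`, so the membership
  -- condition says that `g v` has type `(p, -p-1)` for `gF`. The number required to be positive is
  -- the real part of `i^{2p+1} Q(gv, conj(gv))`.
  positive : ∃ c : ℝ, ∀ y : ℝ, c < y → ∀ p, ∀ v ∈ F p, v ≠ 0 →
    star v - (2 * Complex.I * y) • T (star v) ∈ F (-p - 1) →
    0 < (-1 : ℝ) ^ p *
      ((Complex.I * Q n ℂ v (star v)).re + 2 * y * (Q n ℂ v (T (star v))).re)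

/-- The subspace `I^{p,-p}` for a square-zero endomorphism `T`. -/
def deligneZero {n : ℕ} (T : H n ℂ →ₗ[ℂ] H n ℂ) (F : ℤ → Submodule ℂ (H n ℂ)) (p : ℤ) :
    Submodule ℂ (H n ℂ) :=
  F p ⊓ (conj (F (-p)) ⊔ conj (F (-p - 1)) ⊓ LinearMap.range T)

namespace SquareZeroOrbit

variable {n : ℕ} {T : H n ℂ →ₗ[ℂ] H n ℂ} {F : ℤ → Submodule ℂ (H n ℂ)}

theorem isotropic (hT : SquareZeroOrbit T F) {p q : ℤ} (hpq : p + q = 0) {v w : H n ℂ}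
    (hv : v ∈ F p) (hw : w ∈ F q) : Q n ℂ v w = 0 := by
  obtain rfl : q = -p := by omega
  rw [← hT.orthogonal] at hw
  exact hw v hv

theorem mem_of_isotropic (hT : SquareZeroOrbit T F) {p q : ℤ} (hpq : p + q = 0) {w : H n ℂ}
    (hw : ∀ v ∈ F p, Q n ℂ v w = 0) : w ∈ F q := by
  obtain rfl : q = -p := by omega
  rw [← hT.orthogonal]
  exact hw

theorem isotropic_star (hT : SquareZeroOrbit T F) {p q : ℤ} (hpq : p + q = 0) {v w : H n ℂ}
    (hv : star v ∈ F p) (hw : star w ∈ F q) : Q n ℂ v w = 0 := by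
  have := hT.isotropic hpq hv hw
  rwa [Q_star, star_eq_zero] at this

theorem map_mem (hT : SquareZeroOrbit T F) {p q : ℤ} (hpq : q = p - 1) {v : H n ℂ}
    (hv : v ∈ F p) : T v ∈ F q := hpq ▸ hT.horizontal p v hv

theorem mem_of_le (hT : SquareZeroOrbit T F) {p q : ℤ} (hpq : q ≤ p) {v : H n ℂ}
    (hv : v ∈ F p) : v ∈ F q := hT.antitone hpq hv

theorem mem_ker_star (hT : SquareZeroOrbit T F) {v : H n ℂ} (hv : T v = 0) : T (star v) = 0 := by
  rw [hT.map_star, hv, star_zero]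

/-- An invariant vector of type `(p, -p-1)` that is isotropic vanishes. -/
theorem eq_zero_of_isotropic (hT : SquareZeroOrbit T F) {p q : ℤ} (hpq : p + q = -1) {v : H n ℂ}
    (hTv : T v = 0) (hv : v ∈ F p) (hv' : star v ∈ F q) (hQ : Q n ℂ v (star v) = 0) : v = 0 := by
  obtain rfl : q = -p - 1 := by omega
  by_contra h0
  obtain ⟨c, hc⟩ := hT.positive
  have := hc (c + 1) (by linarith) p v hv h0
    (by rw [hT.mem_ker_star hTv, smul_zero, sub_zero]; exact hv')
  simp [hT.mem_ker_star hTv, hQ] at this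

/-- The image of `T` is isotropic and contained in `ker T`, so positivity leaves no room for such a
vector. -/
theorem eq_zero_of_mem_range (hT : SquareZeroOrbit T F) {p q : ℤ} (hpq : p + q = -1) {v : H n ℂ}
    (hTv : v ∈ LinearMap.range T) (hv : v ∈ F p) (hv' : star v ∈ F q) : v = 0 := by
  obtain ⟨w, rfl⟩ := hTv
  refine hT.eq_zero_of_isotropic hpq (hT.sq_zero w) hv hv' ?_
  rw [hT.skew, hT.mem_ker_star (hT.sq_zero w), map_zero, neg_zero]

theorem mem_ker_of_orthogonal_range (hT : SquareZeroOrbit T F) {u : H n ℂ}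
    (hu : ∀ v, Q n ℂ (T v) u = 0) : T u = 0 :=
  Q_separating fun w => by rw [← neg_eq_zero, ← hT.skew, hu]

theorem Q_range_ker (hT : SquareZeroOrbit T F) {u v : H n ℂ} (hv : v ∈ LinearMap.range T)
    (hu : T u = 0) : Q n ℂ v u = 0 := by
  obtain ⟨w, rfl⟩ := hv
  rw [hT.skew, hu, map_zero, neg_zero]

theorem orthogonal_conj_le (hT : SquareZeroOrbit T F) {p q : ℤ} (hpq : p + q = 0) :
    (conj (F p)).orthogonalBilin (Q n ℂ) ≤ conj (F q) := by
  intro u hu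
  refine hT.mem_of_isotropic hpq fun v hv => ?_
  have := hu (star v) (by rw [mem_conj, star_star]; exact hv)
  rw [← star_star v, Q_star]
  exact star_eq_zero.2 this

/-- The Hodge decomposition of the image of `T`. -/
theorem range_decomposition (hT : SquareZeroOrbit T F) (p q : ℤ) (hpq : p + q = 0) {x : H n ℂ}
    (hx : x ∈ LinearMap.range T) :
    ∃ v ∈ F p, ∃ z ∈ LinearMap.range T, star z ∈ F q ∧ x = T v + z := by
  suffices h : LinearMap.range T ≤ (F p).map T ⊔ (LinearMap.range T ⊓ conj (F q)) by
    obtain ⟨_, ⟨v, hv, rfl⟩, z, hz, h⟩ := Submodule.mem_sup.1 (h hx)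
    exact ⟨v, hv, z, hz.1, hz.2, h.symm⟩
  -- If `u` is orthogonal to both summands, the first gives `T u ∈ F^q` and the second `u ∈ ker T +
  -- conj F^p`.
  refine le_of_orthogonal_le fun u hu => ?_
  suffices hTu : T u = 0 from fun a ha => hT.Q_range_ker ha hTu
  have h1 : ∀ v ∈ F p, Q n ℂ v (T u) = 0 := fun v hv => by
    rw [← neg_eq_zero, ← hT.skew]
    exact hu _ (Submodule.mem_sup_left ⟨v, hv, rfl⟩)
  have h2 : u ∈ LinearMap.ker T ⊔ conj (F p) := by
    refine mem_sup_of_orthogonal_inf (A := LinearMap.range T) (B := conj (F q)) ?_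
      (hT.orthogonal_conj_le (by omega)) fun b hb => hu b (Submodule.mem_sup_right hb)
    exact fun w hw => hT.mem_ker_of_orthogonal_range fun v => hw _ ⟨v, rfl⟩
  obtain ⟨k, hk, w, hw, rfl⟩ := Submodule.mem_sup.1 h2
  have hk : T k = 0 := hk
  rw [map_add, hk, zero_add] at h1 ⊢
  -- `T w̄` lies in `im T ∩ F^{p-1}` and its conjugate in `F^q`, with `(p-1) + q = -1`.
  have h3 : T (star w) = 0 := by
    refine hT.eq_zero_of_mem_range (p := p - 1) (q := q) (by omega) ⟨_, rfl⟩
      (hT.map_mem rfl hw) ?_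
    rw [hT.map_star, star_star]
    exact hT.mem_of_isotropic hpq h1
  rw [← star_star w, hT.map_star, h3, star_zero]

/-- The Hodge decomposition of the kernel of `T` modulo its image. -/
theorem ker_decomposition (hT : SquareZeroOrbit T F) (p : ℤ) {x : H n ℂ} (hx : T x = 0) :
    ∃ a ∈ F p, T a = 0 ∧ ∃ b, star b ∈ F (-p) ∧ T b = 0 ∧ ∃ l ∈ LinearMap.range T,
      x = a + b + l := by
  suffices h : LinearMap.ker T ≤ (F p ⊓ LinearMap.ker T) ⊔ (conj (F (-p)) ⊓ LinearMap.ker T) ⊔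
      LinearMap.range T by
    obtain ⟨_, hab, l, hl, rfl⟩ := Submodule.mem_sup.1 (h hx)
    obtain ⟨a, ha, b, hb, rfl⟩ := Submodule.mem_sup.1 hab
    exact ⟨a, ha.1, ha.2, b, hb.1, hb.2, l, hl, rfl⟩
  refine le_of_orthogonal_le fun u hu => ?_
  suffices hTu : u ∈ LinearMap.range T from fun a ha => by
    rw [Q_swap, hT.Q_range_ker hTu ha, neg_zero]
  have hker : (LinearMap.ker T).orthogonalBilin (Q n ℂ) ≤ LinearMap.range T := by
    refine le_of_orthogonal_le fun w hw a ha => ?_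
    rw [Q_swap, ha w, neg_zero]
    exact hT.mem_ker_of_orthogonal_range fun v => hw _ ⟨v, rfl⟩
  have hu0 : T u = 0 := hT.mem_ker_of_orthogonal_range fun v =>
    hu _ (Submodule.mem_sup_right ⟨v, rfl⟩)
  have h1 : u ∈ F (-p) ⊔ LinearMap.range T :=
    mem_sup_of_orthogonal_inf (hT.orthogonal p).le hker
      fun b hb => hu b (Submodule.mem_sup_left (Submodule.mem_sup_left hb))
  have h2 : u ∈ conj (F p) ⊔ LinearMap.range T :=
    mem_sup_of_orthogonal_inf (hT.orthogonal_conj_le (p := -p) (by omega)) hker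
      fun b hb => hu b (Submodule.mem_sup_left (Submodule.mem_sup_right hb))
  obtain ⟨a, ha, l, hl, hal⟩ := Submodule.mem_sup.1 h1
  obtain ⟨b, hb, m, hm, hbm⟩ := Submodule.mem_sup.1 h2
  have range_ker : ∀ x ∈ LinearMap.range T, T x = 0 := by
    rintro _ ⟨w, rfl⟩
    exact hT.sq_zero w
  -- With the index `1 - p`, `T w` can be absorbed into `a ∈ F^{-p}` and `z` into `b`; the common
  -- vector `a - T w = b + z` then has type `(-p, p-1)`.
  obtain ⟨w, hw, z, hz, hz', hmz⟩ := hT.range_decomposition (1 - p) (p - 1) (by omega)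
    ((LinearMap.range T).sub_mem hm hl)
  have hsub : a - T w = b + z := by
    rw [← sub_eq_iff_eq_add'.2 hmz, ← sub_eq_zero]
    have : a + l = b + m := hal.trans hbm.symm
    linear_combination (exp := 1) this
  have ha0 : T (a - T w) = 0 := by
    rw [map_sub, hT.sq_zero, sub_zero]
    have := hu0
    rwa [← hal, map_add, range_ker l hl, add_zero] at this
  have haF : a - T w ∈ F (-p) := (F (-p)).sub_mem ha (hT.map_mem (by omega) hw)
  have h0 : a - T w = 0 := by
    refine hT.eq_zero_of_isotropic (p := -p) (q := p - 1) (by omega) ha0 haF ?_ ?_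
    · rw [hsub, star_add]
      exact (F (p - 1)).add_mem (hT.mem_of_le (by omega) hb) hz'
    · conv_lhs => rw [show Q n ℂ (a - T w) = Q n ℂ (b + z) by rw [hsub]]
      rw [map_add, LinearMap.add_apply, hT.Q_range_ker hz (hT.mem_ker_star ha0), add_zero]
      exact hT.isotropic_star (p := p) (q := -p) (by omega) hb (by rwa [star_star])
  rw [← hal, sub_eq_zero.1 h0]
  exact Submodule.add_mem _ ⟨w, rfl⟩ hl

theorem mem_deligneZero {p : ℤ} {u : H n ℂ} : u ∈ deligneZero T F p ↔
    u ∈ F p ∧ ∃ a, star a ∈ F (-p) ∧ ∃ k ∈ LinearMap.range T, star k ∈ F (-p - 1) ∧ u = a + k := by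
  constructor
  · rintro ⟨h, h'⟩
    obtain ⟨a, ha, k, hk, rfl⟩ := Submodule.mem_sup.1 h'
    exact ⟨h, a, ha, k, hk.2, hk.1, rfl⟩
  · rintro ⟨h, a, ha, k, hk, hk', rfl⟩
    exact ⟨h, Submodule.add_mem_sup ha ⟨hk', hk⟩⟩

/-- The remainder in `ker T` is invisible to `Q(v, T v̄)`, so this is the inductive step for
determining the sign of that form along the filtration. -/
theorem filtration_decomposition (hT : SquareZeroOrbit T F) (p : ℤ) {v : H n ℂ} (hv : v ∈ F p) :
    ∃ f ∈ F (p + 1), ∃ u ∈ deligneZero T F p, ∃ k, T k = 0 ∧ v = f + u + k := by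
  obtain ⟨f, hf, z, hz, hz', hvz⟩ :=
    hT.range_decomposition (p + 1) (-p - 1) (by omega) (x := T v) ⟨v, rfl⟩
  obtain ⟨z₀, rfl⟩ := hz
  obtain ⟨w, hw, z', hzr', hz'', hwz⟩ :=
    hT.range_decomposition (-p) p (by omega) (x := star (T z₀)) ⟨star z₀, hT.map_star z₀⟩
  -- Both decompositions together give `z'` type `(-p-1, p)` inside `im T`. Hence `T z₀ = T w̄` with
  -- `w ∈ F^{-p}`, so `v - f - w̄` is in `ker T`.
  have hz0 : z' = 0 := by
    refine hT.eq_zero_of_mem_range (p := -p - 1) (q := p) (by omega) hzr' ?_ hz''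
    rw [← sub_eq_iff_eq_add'.2 hwz]
    exact (F (-p - 1)).sub_mem hz' (hT.map_mem rfl hw)
  rw [hz0, add_zero] at hwz
  have hk : T (v - f - star w) = 0 := by
    rw [map_sub, map_sub, hvz, hT.map_star, ← hwz, star_star]
    abel
  obtain ⟨α, hα, hα0, β, hβ, hβ0, l, hl, hkk⟩ := hT.ker_decomposition p hk
  obtain ⟨g, hg, y, hy, hy', hly⟩ := hT.range_decomposition (p + 1) (-p - 1) (by omega) hl
  have hu : v - f - α - T g = star w + β + y := by
    rw [hly] at hkk
    linear_combination (exp := 1) hkk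
  refine ⟨f, hf, v - f - α - T g, mem_deligneZero.2 ⟨?_, star w + β, ?_, y, hy, hy', hu⟩,
    α + T g, ?_, by abel⟩
  · exact (F p).sub_mem ((F p).sub_mem ((F p).sub_mem hv (hT.mem_of_le (by omega) hf)) hα)
      (hT.map_mem (by omega) hg)
  · rw [star_add, star_star]
    exact (F (-p)).add_mem hw hβ
  · rw [map_add, hα0, hT.sq_zero, add_zero]

/-- The polarization of the graded piece of weight `0`. -/
theorem positive_deligneZero (hT : SquareZeroOrbit T F) {p : ℤ} {u : H n ℂ}
    (hu : u ∈ deligneZero T F p) (h0 : u ≠ 0) : ∃ c : ℝ, ∀ y : ℝ, c < y →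
      0 < (-1 : ℝ) ^ p *
      ((Complex.I * Q n ℂ u (star u)).re + 2 * y * (Q n ℂ u (T (star u))).re) := by
  obtain ⟨c, hc⟩ := hT.positive
  refine ⟨c, fun y hy => hc y hy p u (mem_deligneZero.1 hu).1 h0 ?_⟩
  obtain ⟨-, a, ha, _, ⟨k, rfl⟩, hk', rfl⟩ := mem_deligneZero.1 hu
  have : T (star (a + T k)) = T (star a) := by
    rw [star_add, map_add, hT.mem_ker_star (hT.sq_zero k), add_zero]
  rw [this, star_add]
  exact (F (-p - 1)).sub_mem ((F (-p - 1)).add_mem (hT.mem_of_le (by omega) ha) hk')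
    ((F (-p - 1)).smul_mem _ (hT.map_mem rfl ha))

/-- Positivity of `b + 2ya` for all large `y` forces its leading coefficient `a` to be nonnegative.
-/
theorem nonneg_deligneZero (hT : SquareZeroOrbit T F) {p : ℤ} {u : H n ℂ}
    (hu : u ∈ deligneZero T F p) : 0 ≤ (-1 : ℝ) ^ p * (Q n ℂ u (T (star u))).re := by
  by_cases h0 : u = 0
  · simp [h0]
  obtain ⟨c, hc⟩ := hT.positive_deligneZero hu h0
  by_contra! hneg
  set a := (-1 : ℝ) ^ p * (Q n ℂ u (T (star u))).re
  set b := (-1 : ℝ) ^ p * (Complex.I * Q n ℂ u (star u)).re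
  have h := hc (max (c + 1) (-(b / (2 * a)))) (lt_max_of_lt_left (by linarith))
  have h1 := le_max_right (c + 1) (-(b / (2 * a)))
  generalize max (c + 1) (-(b / (2 * a))) = y at h h1
  have h2 : 2 * a * y ≤ 2 * a * (-(b / (2 * a))) :=
    mul_le_mul_of_nonpos_left h1 (by linarith)
  have h3 : 2 * a * (-(b / (2 * a))) = -b := by
    rw [mul_neg, mul_div_cancel₀ _ (by linarith)]
  have h4 : 0 < b + 2 * a * y := by
    convert h using 1
    simp only [a, b]
    ring
  linarith

/-- `I^{p,-p}` does not meet the kernel of `T`. -/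
theorem eq_zero_of_mem_deligneZero (hT : SquareZeroOrbit T F) {p : ℤ} {u : H n ℂ}
    (hu : u ∈ deligneZero T F p) (h0 : T u = 0) : u = 0 := by
  by_contra hne
  obtain ⟨c, hc⟩ := hT.positive_deligneZero hu hne
  obtain ⟨hF, a, ha, k, hk, hk', hak⟩ := mem_deligneZero.1 hu
  -- The part `k ∈ im T` is orthogonal to `ū ∈ ker T`, and the part `a` is orthogonal to `ū` because
  -- `ā ∈ F^{-p}` and `u ∈ F^p`. Both terms of the positive expression therefore vanish.
  have hQ : Q n ℂ u (star u) = 0 := by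
    conv_lhs => rw [show Q n ℂ u = Q n ℂ (a + k) by rw [← hak]]
    rw [map_add, LinearMap.add_apply, hT.Q_range_ker hk (hT.mem_ker_star h0), add_zero]
    exact hT.isotropic_star (p := -p) (q := p) (by omega) ha (by rwa [star_star])
  have := hc (c + 1) (by linarith)
  simp [hQ, hT.mem_ker_star h0] at this

theorem hermitian (hT : SquareZeroOrbit T F) (v w : H n ℂ) :
    Q n ℂ v (T (star w)) = star (Q n ℂ w (T (star v))) := by
  rw [← Q_star, ← hT.map_star, star_star, Q_swap, hT.skew, neg_neg]

/-- If only the `I^{p,-p}` of one parity occur, the form `Q(v, T v̄)` is semidefinite. -/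
theorem semidefinite (hT : SquareZeroOrbit T F) (s : ℝ) (hs : s = 1 ∨ s = -1)
    (h : ∀ p : ℤ, s * (-1) ^ p = -1 → deligneZero T F p = ⊥) (v : H n ℂ) :
    0 ≤ s * (Q n ℂ v (T (star v))).re := by
  obtain ⟨t, ht⟩ := hT.exists_top
  obtain ⟨b, hb⟩ := hT.exists_bot
  -- Descending induction along the filtration: `m` bounds the number of steps from `p` up to an
  -- index where `F` vanishes.
  suffices key : ∀ (m : ℕ) (p : ℤ), b ≤ p + m → ∀ v ∈ F p, 0 ≤ s * (Q n ℂ v (T (star v))).re by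
    refine key (b - t).toNat t (by omega) v ?_
    rw [ht]
    trivial
  intro m
  induction m with
  | zero =>
    intro p hp v hv
    have : v ∈ F b := hT.mem_of_le (by omega) hv
    rw [hb, Submodule.mem_bot] at this
    simp [this]
  | succ m ih =>
    intro p hp v hv
    obtain ⟨f, hf, u, hu, k, hk, rfl⟩ := hT.filtration_decomposition p hv
    have hfu : Q n ℂ f (T (star u)) = 0 := by
      obtain ⟨-, a, ha, _, ⟨k, rfl⟩, -, rfl⟩ := mem_deligneZero.1 hu
      rw [star_add, map_add, hT.mem_ker_star (hT.sq_zero k), add_zero]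
      exact hT.isotropic (p := p + 1) (q := -p - 1) (by omega) hf (hT.map_mem rfl ha)
    have huf : Q n ℂ u (T (star f)) = 0 := by rw [hT.hermitian, hfu, star_zero]
    have hk1 : ∀ x, Q n ℂ k (T x) = 0 := fun x => by
      rw [← neg_eq_zero, ← hT.skew, hk, map_zero, LinearMap.zero_apply]
    have hsum : Q n ℂ (f + u + k) (T (star (f + u + k))) =
        Q n ℂ f (T (star f)) + Q n ℂ u (T (star u)) := by
      simp [hT.mem_ker_star hk, hk1, hfu, huf]
    rw [hsum, Complex.add_re, mul_add]
    refine add_nonneg (ih (p + 1) (by push_cast at hp; omega) f hf) ?_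
    by_cases hsp : s * (-1 : ℝ) ^ p = -1
    · have hu0 : u = 0 := by simpa [h p hsp] using hu
      simp [hu0]
    · have h1 := hT.nonneg_deligneZero hu
      rcases neg_one_zpow_eq p with hp | hp <;> rcases hs with rfl | rfl <;>
        simp_all

/-- If `Q(v, T v̄)` is semidefinite, only the `I^{p,-p}` of one parity occur. -/
theorem deligneZero_eq_bot (hT : SquareZeroOrbit T F) (s : ℝ)
    (h : ∀ v, 0 ≤ s * (Q n ℂ v (T (star v))).re)
    (hker : ∀ v, (Q n ℂ v (T (star v))).re = 0 → T v = 0) {p : ℤ} (hp : s * (-1) ^ p = -1) :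
    deligneZero T F p = ⊥ := by
  refine (Submodule.eq_bot_iff _).2 fun u hu => hT.eq_zero_of_mem_deligneZero hu (hker u ?_)
  have h1 := hT.nonneg_deligneZero hu
  have h2 := h u
  rcases neg_one_zpow_eq p with h3 | h3
  · obtain rfl : s = -1 := by simpa [h3] using hp
    rw [h3] at h1
    linarith
  · obtain rfl : s = 1 := by simpa [h3] using hp
    rw [h3] at h1
    linarith

end SquareZeroOrbit

/-! ### Real and complex endomorphisms -/

section Complexification

variable {n : ℕ}

theorem Q_skew_of_adjoint {K : Type} [Field K] {N : EndMat n K}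
    (hN : N.transpose * Matrix.J (Fin n) K = Matrix.J (Fin n) K * -N) (v w : H n K) :
    Q n K (N.mulVec v) w = -Q n K v (N.mulVec w) := by
  have hJ : (Matrix.fromBlocks 0 1 (-1) 0 : EndMat n K) = -Matrix.J (Fin n) K := by
    simp [Matrix.J, Matrix.fromBlocks_neg]
  rw [Q, hJ, Matrix.toLinearMap₂'_apply', Matrix.toLinearMap₂'_apply', Matrix.dotProduct_mulVec,
    ← Matrix.vecMul_transpose, Matrix.vecMul_vecMul, Matrix.mul_neg, hN, ← Matrix.dotProduct_mulVec,
    ← dotProduct_neg]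
  simp [Matrix.mulVec_mulVec, Matrix.neg_mulVec]

theorem adjoint_of_mem_sp {N : EndMat n ℝ} (hN : N ∈ LieAlgebra.Symplectic.sp (Fin n) ℝ) :
    N.transpose * Matrix.J (Fin n) ℝ = Matrix.J (Fin n) ℝ * -N :=
  (mem_skewAdjointMatricesSubmodule _ _).1 ((mem_skewAdjointMatricesLieSubalgebra _ _).1 hN)

theorem toC_mul (M N : EndMat n ℝ) : toC (M * N) = toC M * toC N :=
  Matrix.map_mul (f := Complex.ofRealHom)

theorem toC_smul (c : ℝ) (N : EndMat n ℝ) : toC (c • N) = (c : ℂ) • toC N := by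
  ext i j
  simp [toC]

theorem toC_sum {ι : Type} (s : Finset ι) (f : ι → EndMat n ℝ) :
    toC (∑ j ∈ s, f j) = ∑ j ∈ s, toC (f j) := by
  ext i j
  simp [toC, Matrix.sum_apply]

theorem toC_adjoint {N : EndMat n ℝ} (hN : N ∈ LieAlgebra.Symplectic.sp (Fin n) ℝ) :
    (toC N).transpose * Matrix.J (Fin n) ℂ = Matrix.J (Fin n) ℂ * -toC N := by
  have hJ : toC (Matrix.J (Fin n) ℝ) = Matrix.J (Fin n) ℂ := by
    ext i j
    rcases i with i | i <;> rcases j with j | j <;>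
      simp [toC, Matrix.J, Matrix.one_apply, apply_ite]
  have h := congrArg toC (adjoint_of_mem_sp hN)
  rw [toC_mul, toC_mul, hJ] at h
  have hneg : toC (-N) = -toC N := by
    ext i j
    simp [toC]
  rwa [hneg] at h

/-- The inclusion `H_ℝ → H_ℂ`. -/
def ofRealVec (x : H n ℝ) : H n ℂ := fun i => (x i : ℂ)

theorem toC_mulVec (N : EndMat n ℝ) (x : H n ℝ) :
    (toC N).mulVec (ofRealVec x) = ofRealVec (N.mulVec x) := by
  ext i
  simp [toC, ofRealVec, Matrix.mulVec, dotProduct]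

theorem star_ofRealVec (x : H n ℝ) : star (ofRealVec x) = ofRealVec x := by
  ext i
  simp [ofRealVec]

theorem Q_ofRealVec (x y : H n ℝ) : Q n ℂ (ofRealVec x) (ofRealVec y) = (Q n ℝ x y : ℂ) := by
  simp [Q_apply, ofRealVec]

theorem re_add_im (v : H n ℂ) :
    v = ofRealVec (fun i => (v i).re) + Complex.I • ofRealVec (fun i => (v i).im) := by
  ext i
  simp [ofRealVec, mul_comm Complex.I]

theorem toC_mulVec_star (N : EndMat n ℝ) (v : H n ℂ) :
    (toC N).mulVec (star v) = star ((toC N).mulVec v) := by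
  ext i
  simp [toC, Matrix.mulVec, dotProduct]

theorem Q_toC_star (N : EndMat n ℝ) (v : H n ℂ) :
    (Q n ℂ v ((toC N).mulVec (star v))).re =
      Q n ℝ (fun i => (v i).re) (N.mulVec fun i => (v i).re) +
      Q n ℝ (fun i => (v i).im) (N.mulVec fun i => (v i).im) := by
  set x : H n ℝ := fun i => (v i).re
  set y : H n ℝ := fun i => (v i).im
  have hv : v = ofRealVec x + Complex.I • ofRealVec y := re_add_im v
  rw [hv]
  simp [star_ofRealVec, Matrix.mulVec_add, Matrix.mulVec_smul, toC_mulVec, Q_ofRealVec,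
    Matrix.mulVec_neg]

theorem complexify_top : complexify (⊤ : Submodule ℝ (H n ℝ)) = ⊤ := by
  refine eq_top_iff.2 fun v _ => ?_
  rw [re_add_im v]
  exact Submodule.add_mem _ (Submodule.subset_span ⟨_, trivial, rfl⟩)
    (Submodule.smul_mem _ _ (Submodule.subset_span ⟨_, trivial, rfl⟩))

theorem complexify_bot : complexify (⊥ : Submodule ℝ (H n ℝ)) = ⊥ := by
  refine Submodule.span_eq_bot.2 ?_
  rintro _ ⟨x, hx, rfl⟩
  obtain rfl : x = 0 := hx
  ext i
  simp

theorem complexify_range (N : EndMat n ℝ) :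
    complexify (LinearMap.range N.mulVecLin) = LinearMap.range (toC N).mulVecLin := by
  refine le_antisymm (Submodule.span_le.2 ?_) ?_
  · rintro _ ⟨_, ⟨x, rfl⟩, rfl⟩
    exact ⟨ofRealVec x, toC_mulVec N x⟩
  · rintro _ ⟨v, rfl⟩
    rw [re_add_im v, map_add, map_smul]
    refine Submodule.add_mem _ (Submodule.subset_span ⟨_, ⟨_, rfl⟩, (toC_mulVec N _).symm⟩)
      (Submodule.smul_mem _ _ (Submodule.subset_span ⟨_, ⟨_, rfl⟩, (toC_mulVec N _).symm⟩))

end Complexification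

/-! ### Monodromy weight filtrations of square-zero endomorphisms -/

namespace IsMonodromyWeightFiltration

variable {n : ℕ} {N : EndMat n ℝ} {W : ℤ → Submodule ℝ (H n ℝ)}

theorem pow_mem_of_range_le (hW : IsMonodromyWeightFiltration N W)
    (h : LinearMap.range N.mulVecLin ≤ W (-2)) (k : ℕ) (v : H n ℝ) :
    (N ^ (k + 1)).mulVec v ∈ W (-2 * (k + 1)) := by
  induction k with
  | zero => simpa using h ⟨v, rfl⟩
  | succ k ih =>
    rw [pow_succ', ← Matrix.mulVec_mulVec]
    refine hW.monotone ?_ (hW.map_le _ ⟨_, ih, rfl⟩)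
    push_cast
    linarith

/-- The hypothesis says that `N^k` induces zero on the graded pieces for `k ≥ 2`. As these maps are
isomorphisms, the pieces of weight `≥ 1` vanish; `neg_three_eq_bot` is the dual statement for
weights `≤ -3`. -/
theorem zero_eq_top (hW : IsMonodromyWeightFiltration N W)
    (h : ∀ k : ℕ, 2 ≤ k → ∀ v, (N ^ k).mulVec v ∈ W (-2 - k)) : W 0 = ⊤ := by
  obtain ⟨t, ht⟩ := hW.exists_top
  suffices key : ∀ m : ℕ, W m = ⊤ → W 0 = ⊤ by
    refine key t.toNat (eq_top_iff.2 ?_)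
    rw [← ht]
    exact hW.monotone (by omega)
  intro m
  induction m with
  | zero => exact fun h => by simpa using h
  | succ m ih =>
    refine fun hm => ih (eq_top_iff.2 fun v _ => ?_)
    have := hW.gr_injective (m + 2) v
      (by rw [show (-1 + ((m + 2 : ℕ) : ℤ)) = ((m + 1 : ℕ) : ℤ) by push_cast; ring, hm]; trivial)
      (h _ (by omega) v)
    convert this using 2
    push_cast
    ring

theorem neg_three_eq_bot (hW : IsMonodromyWeightFiltration N W)
    (h : ∀ k : ℕ, 2 ≤ k → ∀ v, (N ^ k).mulVec v ∈ W (-2 - k)) : W (-3) = ⊥ := by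
  obtain ⟨b, hb⟩ := hW.exists_bot
  have step : ∀ m : ℕ, W (-3) ≤ W (-3 - m) := by
    intro m
    induction m with
    | zero => simp
    | succ m ih =>
      refine ih.trans ?_
      have h1 := hW.gr_surjective (m + 2)
      have h2 : -1 - ((m + 2 : ℕ) : ℤ) = -3 - m := by push_cast; ring
      have h3 : -2 - ((m + 2 : ℕ) : ℤ) = -3 - (m + 1 : ℕ) := by push_cast; ring
      rw [h2] at h1
      refine h1.trans (sup_le ?_ (hW.monotone h3.le))
      rintro _ ⟨v, -, rfl⟩
      exact h3 ▸ h (m + 2) (by omega) v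
  rw [eq_bot_iff, ← hb]
  exact (step (-3 - b).toNat).trans (hW.monotone (by omega))

/-- Since `N` lowers weights by two, `N^k H ⊆ W_{-2k} ⊆ W_{-2-k}` for `k ≥ 2`. So `W₋₃ = 0`, and
`N²H ⊆ W₋₄` vanishes. -/
theorem sq_zero_of_range_le (hW : IsMonodromyWeightFiltration N W)
    (h : LinearMap.range N.mulVecLin ≤ W (-2)) : N ^ 2 = 0 := by
  have hpow : ∀ k : ℕ, 2 ≤ k → ∀ v, (N ^ k).mulVec v ∈ W (-2 - k) := fun k hk v => by
    obtain ⟨k, rfl⟩ := Nat.exists_eq_add_of_le' (show 1 ≤ k by omega)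
    exact hW.monotone (by push_cast; omega) (hW.pow_mem_of_range_le h k v)
  refine Matrix.ext_of_mulVec_single fun i => ?_
  have h1 := hpow 2 le_rfl (Pi.single i 1)
  have h2 : W (-2 - (2 : ℕ)) ≤ ⊥ := by
    rw [← hW.neg_three_eq_bot hpow]
    exact hW.monotone (by norm_num)
  rw [(Submodule.mem_bot ℝ).1 (h2 h1), Matrix.zero_mulVec]

theorem pow_mem_of_sq_zero (hN : N ^ 2 = 0) (k : ℕ) (hk : 2 ≤ k) (v : H n ℝ) :
    (N ^ k).mulVec v ∈ W (-2 - k) := by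
  rw [pow_eq_zero_of_le hk hN, Matrix.zero_mulVec]
  exact zero_mem _

theorem neg_two_eq_range (hW : IsMonodromyWeightFiltration N W) (hN : N ^ 2 = 0) :
    W (-2) = LinearMap.range N.mulVecLin := by
  refine le_antisymm ?_ ?_
  · have h := hW.gr_surjective 1
    rw [pow_one] at h
    norm_num at h
    rw [hW.neg_three_eq_bot (pow_mem_of_sq_zero hN), sup_bot_eq] at h
    rintro v hv
    obtain ⟨w, -, rfl⟩ := h hv
    exact ⟨w, rfl⟩
  · rintro _ ⟨v, rfl⟩
    refine hW.map_le 0 ⟨v, ?_, rfl⟩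
    rw [hW.zero_eq_top (pow_mem_of_sq_zero hN)]
    trivial

/-- For `N² = 0` the summand `I^{p,-p}` of the Deligne decomposition has a simple form. -/
theorem deligne_eq (hW : IsMonodromyWeightFiltration N W) (hN : N ^ 2 = 0)
    (F : ℤ → Submodule ℂ (H n ℂ)) (p : ℤ) :
    deligne W F p (-p) = deligneZero (toC N).mulVecLin F p := by
  have h0 := hW.zero_eq_top (pow_mem_of_sq_zero hN)
  have h2 := hW.neg_two_eq_range hN
  have h3 : ∀ k ≤ -3, W k = ⊥ := fun k hk =>
    eq_bot_iff.2 (hW.neg_three_eq_bot (pow_mem_of_sq_zero hN) ▸ hW.monotone hk)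
  rw [deligne, deligneZero, add_neg_cancel, h0, complexify_top, inf_top_eq, inf_top_eq]
  congr 2
  refine le_antisymm (iSup_le fun j => ?_) ?_
  · rcases j with _ | j
    · norm_num
      rw [h2, complexify_range]
      exact inf_le_right
    · rw [h3 _ (by push_cast; omega), complexify_bot, inf_bot_eq]
      exact bot_le
  · refine le_iSup_of_le 0 ?_
    norm_num
    rw [h2, complexify_range]
    exact inf_le_right

end IsMonodromyWeightFiltration

/-- The monodromy weight filtration of a square-zero endomorphism. -/
def squareZeroFiltration {n : ℕ} (N : EndMat n ℝ) (k : ℤ) : Submodule ℝ (H n ℝ) :=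
  if 0 ≤ k then ⊤ else if k = -1 then LinearMap.ker N.mulVecLin
  else if k = -2 then LinearMap.range N.mulVecLin else ⊥

/-- Provides a weight filtration for each `N ∈ σ°`, so that a hypothesis on all weight filtrations
of `σ` can be applied to it. -/
theorem isMonodromyWeightFiltration_squareZeroFiltration {n : ℕ} {N : EndMat n ℝ}
    (hN : N ^ 2 = 0) : IsMonodromyWeightFiltration N (squareZeroFiltration N) := by
  have hrk : LinearMap.range N.mulVecLin ≤ LinearMap.ker N.mulVecLin := by
    rintro _ ⟨v, rfl⟩
    simp [← pow_two, hN]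
  have hT : ∀ k : ℤ, 0 ≤ k → squareZeroFiltration N k = ⊤ := fun k hk => if_pos hk
  have h1 : squareZeroFiltration N (-1) = LinearMap.ker N.mulVecLin := by
    simp [squareZeroFiltration]
  have h2 : squareZeroFiltration N (-2) = LinearMap.range N.mulVecLin := by
    simp [squareZeroFiltration]
  have hB : ∀ k : ℤ, k ≤ -3 → squareZeroFiltration N k = ⊥ := fun k hk => by
    rw [squareZeroFiltration, if_neg (by omega), if_neg (by omega), if_neg (by omega)]
  have hcases : ∀ k : ℤ, 0 ≤ k ∨ k = -1 ∨ k = -2 ∨ k ≤ -3 := fun k => by omega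
  have hmono : Monotone (squareZeroFiltration N) := by
    refine monotone_int_of_le_succ fun k => ?_
    rcases hcases k with hk | rfl | rfl | hk
    · rw [hT (k + 1) (by omega)]
      exact le_top
    · rw [hT (-1 + 1) (by omega)]
      exact le_top
    · rw [h2]
      norm_num
      rwa [h1]
    · rw [hB k hk]
      exact bot_le
  refine ⟨hmono, ⟨-3, hB _ le_rfl⟩, ⟨0, hT _ le_rfl⟩, ?_, ?_, ?_⟩
  · rintro k _ ⟨v, hv, rfl⟩
    rcases hcases k with hk | rfl | rfl | hk
    · refine hmono (show (-2 : ℤ) ≤ k - 2 by omega) ?_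
      rw [h2]
      exact ⟨v, rfl⟩
    · rw [h1] at hv
      rw [show N.mulVecLin v = 0 from hv]
      exact zero_mem _
    · rw [h2] at hv
      rw [show N.mulVecLin v = 0 from hrk hv]
      exact zero_mem _
    · rw [hB k hk] at hv
      rw [(Submodule.mem_bot ℝ).1 hv, map_zero]
      exact zero_mem _
  · intro k v hv hNv
    rcases k with _ | _ | k
    · simpa using hNv
    · norm_num at hNv ⊢
      rw [hB (-3) le_rfl] at hNv
      rw [h1]
      exact hNv
    · rw [hT _ (by push_cast; omega)]
      trivial
  · intro k
    rcases k with _ | _ | k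
    · norm_num
    · norm_num
      refine le_sup_of_le_left ?_
      rw [h2, hT 0 le_rfl, Submodule.map_top]
    · rw [hB _ (by push_cast; omega)]
      exact bot_le

theorem exp_of_sq_zero {n : ℕ} {X : EndMat n ℂ} (hX : X ^ 2 = 0) : NormedSpace.exp X = 1 + X := by
  rw [NormedSpace.exp_eq_tsum ℂ]
  dsimp only
  rw [tsum_eq_sum (s := Finset.range 2)]
  · simp [Finset.sum_range_succ]
  · intro k hk
    rw [pow_eq_zero_of_le (by simpa [Nat.succ_le_iff] using hk) hX, smul_zero]

/-! ### Relative interiors of cones -/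

namespace NilpotentCone

variable {n : ℕ} (σ : NilpotentCone n)

theorem relInt_subset {N : EndMat n ℝ} (hN : N ∈ σ.relInt) : N ∈ σ.cone :=
  intrinsicInterior_subset hN

theorem eventually_lineMap_mem {N N' : EndMat n ℝ} (hN : N ∈ σ.relInt) (hN' : N' ∈ σ.cone) :
    ∀ᶠ t in nhds (0 : ℝ), (1 - t) • N + t • N' ∈ σ.relInt := by
  obtain ⟨x, hx, rfl⟩ := mem_intrinsicInterior.1 hN
  let x' : affineSpan ℝ (σ.cone : Set (EndMat n ℝ)) := ⟨N', subset_affineSpan ℝ _ hN'⟩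
  have hmem : ∀ t : ℝ, (1 - t) • (x : EndMat n ℝ) + t • N' ∈
      affineSpan ℝ (σ.cone : Set (EndMat n ℝ)) := fun t => by
    rw [← AffineMap.lineMap_apply_module]
    exact AffineMap.lineMap_mem t x.2 x'.2
  let f : ℝ → affineSpan ℝ (σ.cone : Set (EndMat n ℝ)) :=
    fun t => ⟨(1 - t) • (x : EndMat n ℝ) + t • N', hmem t⟩
  have hf : Continuous f := by
    refine Continuous.subtype_mk ?_ _
    fun_prop
  have hf0 : f 0 = x := Subtype.ext (by simp [f])
  have := hf.continuousAt.preimage_mem_nhds (x := 0)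
    (hf0.symm ▸ isOpen_interior.mem_nhds hx)
  filter_upwards [this] with t ht
  exact mem_intrinsicInterior.2 ⟨f t, ht, rfl⟩

theorem exists_neg_lineMap_mem {N N' : EndMat n ℝ} (hN : N ∈ σ.relInt) (hN' : N' ∈ σ.cone) :
    ∃ t < (0 : ℝ), (1 - t) • N + t • N' ∈ σ.relInt := by
  obtain ⟨ε, hε, h⟩ := Metric.eventually_nhds_iff.1 (σ.eventually_lineMap_mem hN hN')
  exact ⟨-(ε / 2), by linarith, h (by simp [abs_of_pos hε, hε])⟩

theorem exists_pos_lineMap_mem {N N' : EndMat n ℝ} (hN : N ∈ σ.relInt) (hN' : N' ∈ σ.cone) :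
    ∃ t > (0 : ℝ), (1 - t) • N + t • N' ∈ σ.relInt := by
  obtain ⟨ε, hε, h⟩ := Metric.eventually_nhds_iff.1 (σ.eventually_lineMap_mem hN hN')
  exact ⟨ε / 2, by linarith, h (by simp [abs_of_pos hε, hε])⟩

theorem exists_nonneg_coeff {N : EndMat n ℝ} (hN : N ∈ σ.cone) :
    ∃ a : Fin σ.len → ℝ, (∀ j, 0 ≤ a j) ∧ N = ∑ j, a j • σ.gen j := by
  obtain ⟨a, ha⟩ := (Submodule.mem_span_range_iff_exists_fun _).1 hN
  exact ⟨fun j => a j, fun j => (a j).2, ha.symm⟩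

/-- Elements of `σ°` are positive combinations of the generators. -/
theorem exists_pos_coeff {N : EndMat n ℝ} (hN : N ∈ σ.relInt) :
    ∃ a : Fin σ.len → ℝ, (∀ j, 0 < a j) ∧ N = ∑ j, a j • σ.gen j := by
  have hP : ∑ j, σ.gen j ∈ σ.cone :=
    Submodule.sum_mem _ fun j _ => Submodule.subset_span ⟨j, rfl⟩
  -- For `t < 0`, `M = (1-t)N + tP` is still in `σ`. Solving for `N` gives `(1-t)⁻¹(M - tP)`, where
  -- `-tP` adds `-t > 0` to every nonnegative coefficient of `M`.
  obtain ⟨t, ht, h⟩ := σ.exists_neg_lineMap_mem hN hP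
  obtain ⟨c, hc, hsum⟩ := σ.exists_nonneg_coeff (σ.relInt_subset h)
  refine ⟨fun j => (1 - t)⁻¹ * (c j - t), fun j => ?_, ?_⟩
  · exact mul_pos (inv_pos.2 (by linarith)) (by linarith [hc j])
  · simp only [mul_smul, ← Finset.smul_sum, sub_smul, Finset.sum_sub_distrib]
    rw [← hsum, add_sub_cancel_right, smul_smul, inv_mul_cancel₀ (by linarith), one_smul]

theorem cone_mem_sp {N : EndMat n ℝ} (hN : N ∈ σ.cone) :
    N ∈ LieAlgebra.Symplectic.sp (Fin n) ℝ := by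
  obtain ⟨a, -, rfl⟩ := σ.exists_nonneg_coeff hN
  exact sum_mem fun j _ => SMulMemClass.smul_mem _ (σ.gen_mem j)

theorem cone_commute {N N' : EndMat n ℝ} (hN : N ∈ σ.cone) (hN' : N' ∈ σ.cone) :
    Commute N N' := by
  obtain ⟨a, -, rfl⟩ := σ.exists_nonneg_coeff hN
  obtain ⟨b, -, rfl⟩ := σ.exists_nonneg_coeff hN'
  exact Commute.sum_left _ _ _ fun j _ => Commute.sum_right _ _ _ fun k _ =>
    ((σ.gen_commute j k).smul_left _).smul_right _

theorem Q_skew {N : EndMat n ℝ} (hN : N ∈ σ.cone) (v w : H n ℝ) :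
    Q n ℝ (N.mulVec v) w = -Q n ℝ v (N.mulVec w) :=
  Q_skew_of_adjoint (adjoint_of_mem_sp (σ.cone_mem_sp hN)) v w

theorem squareZeroOrbit {h : ℤ → ℕ} {F : ℤ → Submodule ℂ (H n ℂ)} (hF : σ.IsNilpotentOrbit h F)
    {N : EndMat n ℝ} (hN : N ∈ σ.relInt) (hN2 : N ^ 2 = 0) :
    SquareZeroOrbit (toC N).mulVecLin F where
  map_star := toC_mulVec_star N
  skew := Q_skew_of_adjoint (toC_adjoint (σ.cone_mem_sp (σ.relInt_subset hN)))
  sq_zero v := by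
    rw [Matrix.mulVecLin_apply, Matrix.mulVecLin_apply, Matrix.mulVec_mulVec, ← toC_mul, ← pow_two,
      hN2]
    ext i
    simp [toC, Matrix.mulVec, dotProduct]
  antitone := hF.compactDual.antitone
  exists_top := hF.compactDual.exists_top
  exists_bot := hF.compactDual.exists_bot
  orthogonal := hF.compactDual.orthogonal
  horizontal p v hv := hF.horizontal N (σ.relInt_subset hN) p ⟨v, hv, rfl⟩
  positive := by
    obtain ⟨c, hc⟩ := hF.eventually_mem
    obtain ⟨a, ha, hNa⟩ := σ.exists_pos_coeff hN
    -- Writing `N = ∑ a_j N_j` with `a_j > 0`, this bound on `y` makes every `x_j = y a_j` exceed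
    -- `c`.
    refine ⟨∑ j, |c| / a j, fun y hy p v hv hv0 hv' => ?_⟩
    have hD := hc (fun j => y * a j) fun j => by
      have h1 : |c| / a j ≤ ∑ j, |c| / a j :=
        Finset.single_le_sum (f := fun j => |c| / a j)
          (fun j _ => div_nonneg (abs_nonneg c) (ha j).le) (Finset.mem_univ j)
      exact (le_abs_self c).trans_lt ((div_lt_iff₀ (ha j)).1 (h1.trans_lt hy))
    have hX : ∑ j, (Complex.I * ((y * a j : ℝ) : ℂ)) • toC (σ.gen j) =
        (Complex.I * y) • toC N := by
      rw [hNa, toC_sum, Finset.smul_sum]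
      refine Finset.sum_congr rfl fun j _ => ?_
      rw [toC_smul, smul_smul, Complex.ofReal_mul, mul_assoc]
    have hX2 : ((Complex.I * y) • toC N) ^ 2 = 0 := by
      rw [smul_pow, pow_two (toC N), ← toC_mul, ← pow_two, hN2]
      ext i j
      simp [toC]
    rw [hX, exp_of_sq_zero hX2] at hD
    set g : EndMat n ℂ := 1 + (Complex.I * y) • toC N
    have hg : ∀ x, g.mulVec x = x + (Complex.I * y) • (toC N).mulVec x := fun x => by
      rw [Matrix.add_mulVec, Matrix.one_mulVec, Matrix.smul_mulVec]
    have hT2 : ∀ x, (toC N).mulVec ((toC N).mulVec x) = 0 := fun x => by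
      rw [Matrix.mulVec_mulVec, ← toC_mul, ← pow_two, hN2]
      ext i
      simp [toC, Matrix.mulVec, dotProduct]
    have hgstar : star (g.mulVec v) = star v - (Complex.I * y) • (toC N).mulVec (star v) := by
      rw [hg, star_add, star_smul, toC_mulVec_star]
      simp [sub_eq_add_neg]
    have hmem : g.mulVec v ∈ hodgeComponent (translate g F) p := by
      refine ⟨⟨v, hv, rfl⟩, _, hv', ?_⟩
      rw [hgstar, Matrix.mulVecLin_apply, Matrix.mulVecLin_apply, hg, Matrix.mulVec_sub,
        Matrix.mulVec_smul, hT2, smul_zero, sub_zero, mul_assoc 2, two_mul, add_smul]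
      abel
    have hne : g.mulVec v ≠ 0 := fun h0 => hv0 <| by
      have h1 := congrArg (toC N).mulVec h0
      rw [hg, Matrix.mulVec_add, Matrix.mulVec_smul, hT2, smul_zero, add_zero,
        Matrix.mulVec_zero] at h1
      rw [hg, h1, smul_zero, add_zero] at h0
      exact h0
    have hpos := hD.positive p _ hmem hne
    have hskew := Q_skew_of_adjoint (toC_adjoint (σ.cone_mem_sp (σ.relInt_subset hN)))
    have hQ : Q n ℂ (g.mulVec v) (star (g.mulVec v)) =
        Q n ℂ v (star v) - 2 * (Complex.I * y) * Q n ℂ v ((toC N).mulVec (star v)) := by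
      rw [hgstar, hg]
      simp only [map_add, map_sub, map_smul, LinearMap.add_apply, LinearMap.smul_apply, hskew, hT2,
        map_zero, smul_eq_mul]
      ring
    have hI : Complex.I ^ (2 * p + 1) = (((-1 : ℝ) ^ p : ℝ) : ℂ) * Complex.I := by
      rw [zpow_add₀ Complex.I_ne_zero, zpow_mul, zpow_one]
      norm_num [Complex.I_sq]
    rw [hQ, hI, mul_assoc, Complex.re_ofReal_mul] at hpos
    convert hpos using 2
    rw [mul_sub, Complex.sub_re, sub_eq_add_neg]
    congr 1
    rw [show Complex.I * (2 * (Complex.I * y) * Q n ℂ v ((toC N).mulVec (star v))) =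
      ((-(2 * y) : ℝ) : ℂ) * Q n ℂ v ((toC N).mulVec (star v)) by
        push_cast
        linear_combination
          (2 * (y : ℂ) * Q n ℂ v ((toC N).mulVec (star v))) * Complex.I_mul_I,
      Complex.re_ofReal_mul, Matrix.mulVecLin_apply]
    ring

end NilpotentCone

/-! ### Semidefinite symmetric forms -/

theorem mulVec_eq_zero_of_semidefinite {n : ℕ} {N : EndMat n ℝ}
    (hN : N ∈ LieAlgebra.Symplectic.sp (Fin n) ℝ) {s : ℝ}
    (hs : s ≠ 0) (h : ∀ v, 0 ≤ s * Q n ℝ v (N.mulVec v)) {v : H n ℝ}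
    (hv : Q n ℝ v (N.mulVec v) = 0) : N.mulVec v = 0 := by
  refine Q_separating fun w => ?_
  have hsymm : Q n ℝ v (N.mulVec w) = Q n ℝ w (N.mulVec v) := by
    rw [Q_swap, Q_skew_of_adjoint (adjoint_of_mem_sp hN), neg_neg]
  -- Along `v + t w` the form is `2tφ(v,w) + t²φ(w,w)`, of constant sign and without constant term,
  -- so its linear coefficient must vanish.
  have hd := discrim_le_zero (a := s * Q n ℝ w (N.mulVec w)) (b := 2 * (s * Q n ℝ w (N.mulVec v)))
    (c := 0) fun t => by
      have := h (v + t • w)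
      simp only [Matrix.mulVec_add, Matrix.mulVec_smul, map_add, map_smul, LinearMap.add_apply,
        LinearMap.smul_apply, smul_eq_mul, hv, hsymm] at this
      linarith
  rw [discrim, mul_zero, sub_zero] at hd
  have h0 := pow_eq_zero_iff (two_ne_zero) |>.1 (le_antisymm hd (sq_nonneg _))
  simpa [hs] using h0

/-! ### Comparing the elements of a cone, and the equivalence for both parities -/

namespace NilpotentCone

variable {n : ℕ} (σ : NilpotentCone n)

/-- Skewness makes the image the orthogonal complement of the kernel, so inclusions reverse. -/
theorem range_le_of_ker_le {N N' : EndMat n ℝ} (hN : N ∈ σ.cone) (hN' : N' ∈ σ.cone)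
    (h : ∀ v, N.mulVec v = 0 → N'.mulVec v = 0) :
    LinearMap.range N'.mulVecLin ≤ LinearMap.range N.mulVecLin := by
  refine le_of_orthogonal_le fun u hu => ?_
  have hu0 : N.mulVec u = 0 := Q_separating fun w => by
    rw [← neg_eq_zero, ← σ.Q_skew hN]
    exact hu _ ⟨w, rfl⟩
  rintro _ ⟨w, rfl⟩
  rw [Matrix.mulVecLin_apply, σ.Q_skew hN', h u hu0, map_zero, neg_zero]

/-- Move from `N` slightly away from `N'`, staying in `σ°`: at `v ∈ ker N` the form becomes
`tφ_{N'}(v,v)` with `t < 0`. It has the same sign as `φ_{N'}(v,v)`, so both are zero. -/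
theorem ker_le_of_semidefinite {s : ℝ} (hs : s ≠ 0)
    (h : ∀ N ∈ σ.relInt, ∀ v, 0 ≤ s * Q n ℝ v (N.mulVec v)) {N N' : EndMat n ℝ}
    (hN : N ∈ σ.relInt) (hN' : N' ∈ σ.relInt) {v : H n ℝ} (hv : N.mulVec v = 0) :
    N'.mulVec v = 0 := by
  obtain ⟨t, ht, hM⟩ := σ.exists_neg_lineMap_mem hN (σ.relInt_subset hN')
  have h1 := h _ hM v
  simp only [Matrix.add_mulVec, Matrix.smul_mulVec, hv, smul_zero, zero_add, map_smul,
    smul_eq_mul] at h1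
  have h2 := h N' hN' v
  have h3 : s * Q n ℝ v (N'.mulVec v) = 0 := by
    refine le_antisymm ?_ h2
    by_contra! hpos
    nlinarith
  exact mulVec_eq_zero_of_semidefinite (σ.cone_mem_sp (σ.relInt_subset hN')) hs (h N' hN')
    ((mul_eq_zero.1 h3).resolve_left hs)

/-- If `N v = N₀ w` and `N w = N₀ x`, commutativity gives `N² v = N₀ N w = N₀² x = 0`. -/
theorem sq_zero_of_range_le {S : Submodule ℝ (H n ℝ)} {N N₀ : EndMat n ℝ}
    (hN : N ∈ σ.cone) (hN₀ : N₀ ∈ σ.cone) (hS : S = LinearMap.range N₀.mulVecLin)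
    (hN₀2 : N₀ ^ 2 = 0) (hr : LinearMap.range N.mulVecLin ≤ S) : N ^ 2 = 0 := by
  have h0 : ∀ x, N₀.mulVec (N₀.mulVec x) = 0 := fun x => by
    rw [Matrix.mulVec_mulVec, ← pow_two, hN₀2, Matrix.zero_mulVec]
  have h1 : ∀ v, N.mulVec (N.mulVec v) = 0 := fun v => by
    obtain ⟨w, hw⟩ := hS ▸ hr ⟨v, rfl⟩
    obtain ⟨x, hx⟩ := hS ▸ hr ⟨w, rfl⟩
    rw [Matrix.mulVecLin_apply, Matrix.mulVecLin_apply] at hw hx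
    rw [← hw, Matrix.mulVec_mulVec, (σ.cone_commute hN hN₀).eq, ← Matrix.mulVec_mulVec, ← hx, h0]
  refine Matrix.ext_of_mulVec_single fun i => ?_
  rw [pow_two, ← Matrix.mulVec_mulVec, h1, Matrix.zero_mulVec]

/-- Even-type and odd-type cones, treated together: `s = 1` for even-type, `s = -1` for odd-type. -/
theorem relInt_subset_etaPlus_iff {h : ℤ → ℕ} (hσ : σ.GeneratesNilpotentOrbit h)
    {W : ℤ → Submodule ℝ (H n ℝ)} (hW : σ.IsWeightFiltration W) (s : ℝ) (hs : s = 1 ∨ s = -1) :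
    (∀ N ∈ σ.relInt, s • N ∈ etaPlus (W (-2))) ↔
      ∀ F, σ.IsNilpotentOrbit h F → (∀ N ∈ σ.cone, N ^ 2 = 0) ∧
        ∀ W, σ.IsWeightFiltration W → ∀ p : ℤ, s * (-1) ^ p = -1 → deligne W F p (-p) = ⊥ := by
  obtain ⟨N₀, hN₀, hW⟩ := hW
  have hs0 : s ≠ 0 := by rcases hs with rfl | rfl <;> norm_num
  constructor
  · intro hη F hF
    have hrange : ∀ N ∈ σ.relInt, LinearMap.range N.mulVecLin ≤ W (-2) := by
      rintro N hN _ ⟨v, rfl⟩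
      have := (W (-2)).smul_mem s⁻¹ ((hη N hN).1.2 ⟨v, rfl⟩)
      rwa [Matrix.mulVecLin_apply, Matrix.smul_mulVec, smul_smul, inv_mul_cancel₀ hs0,
        one_smul] at this
    have hN₀2 := hW.sq_zero_of_range_le (hrange N₀ hN₀)
    have hW2 := hW.neg_two_eq_range hN₀2
    have hrange' : ∀ N ∈ σ.cone, LinearMap.range N.mulVecLin ≤ W (-2) := by
      rintro N hN _ ⟨v, rfl⟩
      -- An arbitrary `N ∈ σ` is a linear combination of two elements of `σ°`, whose images are
      -- already known to lie in `W₋₂`.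
      obtain ⟨t, ht, hM⟩ := σ.exists_pos_lineMap_mem hN₀ hN
      have h1 := hrange _ hM ⟨v, rfl⟩
      have h2 := (W (-2)).smul_mem t⁻¹
        ((W (-2)).sub_mem h1 ((W (-2)).smul_mem (1 - t) (hrange N₀ hN₀ ⟨v, rfl⟩)))
      simpa [Matrix.add_mulVec, Matrix.smul_mulVec, smul_smul, inv_mul_cancel₀ ht.ne'] using h2
    have hsq : ∀ N ∈ σ.cone, N ^ 2 = 0 := fun N hN =>
      σ.sq_zero_of_range_le hN (σ.relInt_subset hN₀) hW2 hN₀2 (hrange' N hN)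
    refine ⟨hsq, ?_⟩
    rintro W' ⟨N, hN, hW'⟩ p hp
    have hN2 := hsq N (σ.relInt_subset hN)
    rw [hW'.deligne_eq hN2]
    have hreal : ∀ v, 0 ≤ s * Q n ℝ v (N.mulVec v) := fun v => by
      by_cases hv : v ∈ (W (-2)).orthogonalBilin (Q n ℝ)
      · have hv' : Q n ℝ (N.mulVec v) v = 0 := hv _ (hrange N hN ⟨v, rfl⟩)
        rw [Q_swap, hv', neg_zero, mul_zero]
      · have := (hη N hN).2 v hv
        rw [Matrix.smul_mulVec, map_smul, smul_eq_mul] at this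
        exact this.le
    refine (σ.squareZeroOrbit hF hN hN2).deligneZero_eq_bot s (fun v => ?_) (fun v hv => ?_) hp
    · rw [Matrix.mulVecLin_apply, Q_toC_star, mul_add]
      exact add_nonneg (hreal _) (hreal _)
    · rw [Matrix.mulVecLin_apply, Q_toC_star] at hv
      have h1 := hreal fun i => (v i).re
      have h2 := hreal fun i => (v i).im
      have h3 := congrArg (s * ·) hv
      simp only [mul_add, mul_zero] at h3
      have hker : ∀ x, s * Q n ℝ x (N.mulVec x) = 0 → N.mulVec x = 0 := fun x hx =>
        mulVec_eq_zero_of_semidefinite (σ.cone_mem_sp (σ.relInt_subset hN)) hs0 hreal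
          ((mul_eq_zero.1 hx).resolve_left hs0)
      have h4 := hker (fun i => (v i).re) (by linarith)
      have h5 := hker (fun i => (v i).im) (by linarith)
      rw [re_add_im v, Matrix.mulVecLin_apply, Matrix.mulVec_add, Matrix.mulVec_smul, toC_mulVec,
        toC_mulVec, h4, h5]
      ext i
      simp [ofRealVec]
  · intro htype
    obtain ⟨F, hF⟩ := hσ
    obtain ⟨hsq, hI⟩ := htype F hF
    have hreal : ∀ N ∈ σ.relInt, ∀ v, 0 ≤ s * Q n ℝ v (N.mulVec v) := fun N hN v => by
      have hN2 := hsq N (σ.relInt_subset hN)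
      have hWN := isMonodromyWeightFiltration_squareZeroFiltration hN2
      have := (σ.squareZeroOrbit hF hN hN2).semidefinite s hs
        (fun p hp => by rw [← hWN.deligne_eq hN2]; exact hI _ ⟨N, hN, hWN⟩ p hp) (ofRealVec v)
      rwa [star_ofRealVec, Matrix.mulVecLin_apply, toC_mulVec, Q_ofRealVec,
        Complex.ofReal_re] at this
    intro N hN
    have hNc := σ.relInt_subset hN
    have hW2 := hW.neg_two_eq_range (hsq N₀ (σ.relInt_subset hN₀))
    refine ⟨⟨SMulMemClass.smul_mem s (σ.cone_mem_sp hNc), ?_⟩, fun v hv => ?_⟩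
    · rw [hW2]
      rintro _ ⟨v, rfl⟩
      rw [Matrix.mulVecLin_apply, Matrix.smul_mulVec]
      exact Submodule.smul_mem _ s (σ.range_le_of_ker_le (σ.relInt_subset hN₀) hNc
        (fun v hv => σ.ker_le_of_semidefinite hs0 hreal hN₀ hN hv) ⟨v, rfl⟩)
    · rw [Matrix.smul_mulVec, map_smul, smul_eq_mul]
      -- If the form vanishes at `v`, then `N v = 0`, hence `N₀ v = 0`, and so `v` is orthogonal to
      -- `im N₀ = W₋₂`.
      refine (hreal N hN v).lt_of_ne' fun h0 => hv ?_
      have hNv := mulVec_eq_zero_of_semidefinite (σ.cone_mem_sp hNc) hs0 (hreal N hN)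
        ((mul_eq_zero.1 h0).resolve_left hs0)
      have hN₀v := σ.ker_le_of_semidefinite hs0 hreal hN hN₀ hNv
      rw [hW2, Submodule.mem_orthogonalBilin_iff]
      rintro _ ⟨w, rfl⟩
      rw [Matrix.mulVecLin_apply, σ.Q_skew (σ.relInt_subset hN₀), hN₀v, map_zero, neg_zero]

end NilpotentCone

end HodgeCone

theorem mainTheorem5 (n : ℕ) (h : ℤ → ℕ) (σ : HodgeCone.NilpotentCone n)
    (hσ : σ.GeneratesNilpotentOrbit h)
    (W : ℤ → Submodule ℝ (HodgeCone.H n ℝ)) (hW : σ.IsWeightFiltration W) :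
    (σ.relInt ⊆ HodgeCone.etaPlus (W (-2)) ↔ σ.IsEvenType h) ∧
      (σ.relInt ⊆ -HodgeCone.etaPlus (W (-2)) ↔ σ.IsOddType h) := by
  have hodd : ∀ p : ℤ, (1 : ℝ) * (-1) ^ p = -1 ↔ Odd p := fun p => by
    rcases Int.even_or_odd p with hp | hp
    · exact iff_of_false (by norm_num [hp.neg_one_zpow]) (Int.not_odd_iff_even.2 hp)
    · simpa [hp.neg_one_zpow] using hp
  have heven : ∀ p : ℤ, (-1 : ℝ) * (-1) ^ p = -1 ↔ Even p := fun p => by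
    rcases Int.even_or_odd p with hp | hp
    · simpa [hp.neg_one_zpow] using hp
    · exact iff_of_false (by norm_num [hp.neg_one_zpow]) (Int.not_even_iff_odd.2 hp)
  constructor
  · have := σ.relInt_subset_etaPlus_iff hσ hW 1 (Or.inl rfl)
    simp only [one_smul, hodd] at this
    exact this.trans (and_iff_right hσ).symm
  · have := σ.relInt_subset_etaPlus_iff hσ hW (-1) (Or.inr rfl)
    simp only [neg_smul, one_smul, heven] at this
    exact this.trans (and_iff_right hσ).symm
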